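/- All rings are commutative and unital. A bounded archimedean $\ell$-algebra is an $\mathbb R$-algebra $A$ with a lattice order such that $a\le b$ implies $a+c\le b+c$; $0\le a,b$ implies $0\le ab$; $0\le\lambda\in\mathbb R$ and $0\le a$ imply $0\le\lambda a$; for each $a$ there is $n\in\mathbb N$ with $a\le n\cdot 1$; and $na\le b$ for all $n\in\mathbb N$ implies $a\le 0$. We write $\lambda$ for $\lambda\cdot 1\in A$, $a^+=a\vee 0$, $|a|=a\vee(-a)$ and $\|a\|=\inf\{\lambda\in\mathbb R: |a|\le\lambda\}$; $A$ is uniformly complete if this norm is complete. A modal operator on $A$ is a function $\Box:A\to A$ such that for all $a,b\in A$ and $\lambda\in\mathbb R$: $\Box(a\wedge b)=\Box a\wedge\Box b$; $\Box\lambda=\lambda+(1-\lambda)\Box 0$; $\Box(a^+)=(\Box a)^+$; $\Box(a+\lambda)=\Box a+\Box\lambda-\Box 0$; and $\Box(\lambda a)=(\Box\lambda)(\Box a)$ if $\lambda\ge 0$. Let $\boldsymbol{\mathit{mba}\ell}$ be the category of pairs $(A,\Box)$, with $A$ a bounded archimedean $\ell$-algebra and $\Box$ a modal operator on $A$, and unital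 $\ell$-algebra homomorphisms preserving $\Box$; let $\boldsymbol{\mathit{muba}\ell}$ be its full subcategory of uniformly complete objects. For $(A,\Box)\in\boldsymbol{\mathit{mba}\ell}$, an $\ell$-ideal is an ideal $I$ such that $|a|\le|b|$ and $b\in I$ imply $a\in I$. Let $Y_A$ be the set of maximal (proper) $\ell$-ideals of $A$, with the topology whose closed sets are the sets $\{M\in Y_A: I\subseteq M\}$, $I$ an $\ell$-ideal. Define $x R_\Box y$ iff $\Box a\in x$ for all $a\in y$ with $a\ge 0$. For a relation $R$ on a space $X$ and a continuous $f:X\to\mathbb R$, put $(\Box_R f)(x)=\inf f(R[x])$ if $R[x]=\{y: xRy\}\neq\varnothing$ and $(\Box_R f)(x)=1$ otherwise. **Proposition.** For every $(A,\Box)\in\boldsymbol{\mathit{mba}\ell}$, the space $Y_A$ is compact Hausdorff and $R_\Box$ is a continuous relation on it (each $R_\Box[x]$ is closed, $R_\Box^{-1}[F]$ is closed for closed $F$, and $R_\Box^{-1}[U]$ is open for open $U$), and $(C(Y_A),\Box_{R_\Box})$, where $C(Y_A)$ is the algebra of continuous functions $Y_A\to\mathbb R$, is an object of $\boldsymbol{\mathit{muba}\ell}$.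 For $a\in A$ and $M\in Y_A$ there is a unique $\lambda\in\mathbb R$ with $a+M=\lambda+M$, and $\zeta_A(a)(M)=\lambda$ defines a morphism $\zeta_A:(A,\Box)\to(C(Y_A),\Box_{R_\Box})$ of $\boldsymbol{\mathit{mba}\ell}$; in particular $\zeta_A(\Box a)=\Box_{R_\Box}\zeta_A(a)$. It is the uniform completion of $A$: it is injective and norm-preserving, with dense image in the uniformly complete algebra $C(Y_A)$. Finally, $\boldsymbol{\mathit{muba}\ell}$ is a reflective subcategory of $\boldsymbol{\mathit{mba}\ell}$: the inclusion functor has a left adjoint, which sends $(A,\Box)$ to $(C(Y_A),\Box_{R_\Box})$ (up to isomorphism), with unit $\zeta_A$. -/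

import Mathlib

open CategoryTheory

universe u

/-- `A` is a bounded archimedean `ℓ`-algebra: a commutative lattice-ordered ring
(the order is a lattice, and `IsOrderedRing` says that it is compatible with `+` and `*`) that is
an ordered `ℝ`-algebra, has `1` as a strong order unit, and is archimedean. The inequality
`0 ≤ 1`, which is part of `IsOrderedRing`, is automatic when `1` is a strong order unit. -/
class IsBAL (A : Type u) [CommRing A] [Lattice A] [Algebra ℝ A] : Prop extends
    IsOrderedRing A where
  smul_nonneg' : ∀ (r : ℝ) (a : A), 0 ≤ r → 0 ≤ a → 0 ≤ r • a
  bounded : ∀ a : A, ∃ n : ℕ, a ≤ n • (1 : A)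
  archimedean : ∀ a b : A, (∀ n : ℕ, n • a ≤ b) → a ≤ 0

namespace BAL

section Basic

variable (A : Type u) [CommRing A] [Lattice A] [Algebra ℝ A]

variable {A} in
/-- The norm `‖a‖ = inf {r ∈ ℝ | |a| ≤ r}`. -/
noncomputable def lNorm (a : A) : ℝ := sInf {r : ℝ | |a| ≤ algebraMap ℝ A r}

/-- The norm of `A` is complete. -/
def UniformlyComplete : Prop :=
  ∀ s : ℕ → A,
    (∀ ε : ℝ, 0 < ε → ∃ N, ∀ m ≥ N, ∀ n ≥ N, lNorm (s m - s n) < ε) →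
    ∃ a : A, ∀ ε : ℝ, 0 < ε → ∃ N, ∀ n ≥ N, lNorm (s n - a) < ε

variable {A} in
/-- `box` is a modal operator on `A`; `algebraMap ℝ A r` is the real number `r` in `A`, and
`a ⊔ 0` is the positive part of `a`. -/
structure IsModalOperator (box : A → A) : Prop where
  map_inf : ∀ a b, box (a ⊓ b) = box a ⊓ box b
  map_real : ∀ r : ℝ, box (algebraMap ℝ A r) =
    algebraMap ℝ A r + (1 - algebraMap ℝ A r) * box 0
  map_pos : ∀ a, box (a ⊔ 0) = box a ⊔ 0
  map_add_real : ∀ (a : A) (r : ℝ), box (a + algebraMap ℝ A r) =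
    box a + box (algebraMap ℝ A r) - box 0
  map_smul : ∀ (r : ℝ) (a : A), 0 ≤ r → box (r • a) = box (algebraMap ℝ A r) * box a

end Basic

section Yosida

variable {A : Type u} [CommRing A] [Lattice A]

/-- An `ℓ`-ideal is an ideal `I` such that `|a| ≤ |b|` and `b ∈ I` imply `a ∈ I`. -/
def IsLIdeal (I : Ideal A) : Prop := ∀ a b : A, |a| ≤ |b| → b ∈ I → a ∈ I

variable (A) in
/-- The set of maximal (proper) `ℓ`-ideals of `A`. -/
def Yosida : Type u := {M : Ideal A // Maximal (fun I : Ideal A => IsLIdeal I ∧ I ≠ ⊤) M}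

/-- The set of maximal `ℓ`-ideals that contain `I`. -/
def zeroSet (I : Ideal A) : Set (Yosida A) := {M | I ≤ M.1}

theorem abs_mem {I : Ideal A} [IsOrderedRing A] (hI : IsLIdeal I) {a : A} (ha : a ∈ I) :
    |a| ∈ I :=
  hI _ a (by rw [abs_abs]) ha

/-- If `a` is not in the maximal `ℓ`-ideal `M`, then `1 ≤ m + c * |a|` for some `m ∈ M`. -/
theorem exists_one_le [IsOrderedRing A] (M : Yosida A) {a : A} (ha : a ∉ M.1) :
    ∃ m ∈ M.1, ∃ c : A, 1 ≤ m + c * |a| := by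
  obtain ⟨⟨hM, hM1⟩, hmax⟩ := M.2
  let J : Ideal A :=
    { carrier := {x | ∃ m ∈ M.1, 0 ≤ m ∧ ∃ c : A, 0 ≤ c ∧ |x| ≤ m + c * |a|}
      zero_mem' := ⟨0, M.1.zero_mem, le_rfl, 0, le_rfl, by simp⟩
      add_mem' := by
        rintro x y ⟨m, hm, hm0, c, hc, h⟩ ⟨m', hm', hm0', c', hc', h'⟩
        refine ⟨m + m', M.1.add_mem hm hm', add_nonneg hm0 hm0', c + c', add_nonneg hc hc', ?_⟩
        calc |x + y| ≤ |x| + |y| := abs_add_le x y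
          _ ≤ (m + c * |a|) + (m' + c' * |a|) := add_le_add h h'
          _ = _ := by ring
      smul_mem' := by
        rintro d x ⟨m, hm, hm0, c, hc, h⟩
        refine ⟨|d| * m, M.1.mul_mem_left _ hm, mul_nonneg (abs_nonneg d) hm0, |d| * c,
          mul_nonneg (abs_nonneg d) hc, ?_⟩
        have h1 : |d * x| ≤ |d| * |x| := by
          refine abs_le'.mpr ⟨?_, ?_⟩
          · have h2 := mul_nonneg (sub_nonneg.2 (le_abs_self d)) (sub_nonneg.2 (neg_le_abs x))
            have h3 := mul_nonneg (sub_nonneg.2 (neg_le_abs d)) (sub_nonneg.2 (le_abs_self x))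
            have h4 : 0 ≤ 2 • (|d| * |x| - d * x) := by
              have := add_nonneg h2 h3
              convert this using 1
              ring
            exact sub_nonneg.1 (nsmul_two_semiclosed h4)
          · have h2 := mul_nonneg (sub_nonneg.2 (le_abs_self d)) (sub_nonneg.2 (le_abs_self x))
            have h3 := mul_nonneg (sub_nonneg.2 (neg_le_abs d)) (sub_nonneg.2 (neg_le_abs x))
            have h4 : 0 ≤ 2 • (|d| * |x| - -(d * x)) := by
              have := add_nonneg h2 h3
              convert this using 1
              ring
            exact sub_nonneg.1 (nsmul_two_semiclosed h4)
        calc |d • x| ≤ |d| * |x| := h1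
          _ ≤ |d| * (m + c * |a|) := mul_le_mul_of_nonneg_left h (abs_nonneg d)
          _ = _ := by ring }
  have hJ : IsLIdeal J := by
    rintro x y hxy ⟨m, hm, hm0, c, hc, h⟩
    exact ⟨m, hm, hm0, c, hc, hxy.trans h⟩
  have hMJ : M.1 ≤ J := fun x hx =>
    ⟨|x|, abs_mem hM hx, abs_nonneg x, 0, le_rfl, by simp⟩
  have haJ : a ∈ J := ⟨0, M.1.zero_mem, le_rfl, 1, zero_le_one, by simp⟩
  have hJtop : J = ⊤ := by
    by_contra hne
    exact ha (hmax ⟨hJ, hne⟩ hMJ haJ)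
  have h1 : (1 : A) ∈ J := by rw [hJtop]; trivial
  obtain ⟨m, hm, -, c, -, h⟩ := h1
  exact ⟨m, hm, c, (le_abs_self 1).trans h⟩

theorem le_or_le_of_inf_le [IsOrderedRing A] {I J : Ideal A} (hI : IsLIdeal I) (hJ : IsLIdeal J)
    (M : Yosida A) (h : I ⊓ J ≤ M.1) : I ≤ M.1 ∨ J ≤ M.1 := by
  by_contra hcon
  rw [not_or] at hcon
  obtain ⟨a, haI, haM⟩ := Set.not_subset.1 hcon.1
  obtain ⟨b, hbJ, hbM⟩ := Set.not_subset.1 hcon.2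
  obtain ⟨m, hm, c, h1⟩ := exists_one_le M haM
  obtain ⟨m', hm', c', h1'⟩ := exists_one_le M hbM
  have hab : |a| * |b| ∈ M.1 :=
    h ⟨I.mul_mem_right _ (abs_mem hI haI), J.mul_mem_left _ (abs_mem hJ hbJ)⟩
  have hmem : (m + c * |a|) * (m' + c' * |b|) ∈ M.1 := by
    have : (m + c * |a|) * (m' + c' * |b|) =
        (m' + c' * |b|) * m + (c * |a|) * m' + (c * c') * (|a| * |b|) := by ring
    rw [this]
    exact M.1.add_mem (M.1.add_mem (M.1.mul_mem_left _ hm) (M.1.mul_mem_left _ hm'))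
      (M.1.mul_mem_left _ hab)
  have hle : (1 : A) ≤ (m + c * |a|) * (m' + c' * |b|) := one_le_mul_of_one_le_of_one_le h1 h1'
  have h1M : (1 : A) ∈ M.1 := by
    refine M.2.1.1 _ _ ?_ hmem
    rw [abs_of_nonneg zero_le_one]
    exact hle.trans (le_abs_self _)
  exact M.2.1.2 ((Ideal.eq_top_iff_one _).2 h1M)

/-- The closed sets of the Yosida space are the sets `zeroSet I`, where `I` is an `ℓ`-ideal. -/
instance [IsOrderedRing A] : TopologicalSpace (Yosida A) :=
  TopologicalSpace.ofClosed {F | ∃ I : Ideal A, IsLIdeal I ∧ F = zeroSet I}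
    ⟨⊤, fun _ _ _ _ => trivial, by
      refine (Set.eq_empty_of_forall_notMem fun M hM => ?_).symm
      exact M.2.1.2 (top_le_iff.1 hM)⟩
    (by
      intro T hT
      refine ⟨sInf {J | IsLIdeal J ∧ ∀ I, IsLIdeal I → zeroSet I ∈ T → I ≤ J}, ?_, ?_⟩
      · intro a b hab hb
        rw [Submodule.mem_sInf] at hb ⊢
        exact fun J hJ => hJ.1 a b hab (hb J hJ)
      · ext M
        constructor
        · intro hM
          exact sInf_le (a := M.1) (s := {J : Ideal A | IsLIdeal J ∧ ∀ I, IsLIdeal I → zeroSet I ∈ T → I ≤ J})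
            ⟨M.2.1.1, fun I _ hIT => hM _ hIT⟩
        · intro hM F hF
          obtain ⟨I, hI, rfl⟩ := hT hF
          have h1 : I ≤ sInf {J : Ideal A | IsLIdeal J ∧ ∀ I, IsLIdeal I → zeroSet I ∈ T → I ≤ J} :=
            le_sInf fun J hJ => hJ.2 I hI hF
          exact h1.trans hM)
    (by
      rintro _ ⟨I, hI, rfl⟩ _ ⟨J, hJ, rfl⟩
      refine ⟨I ⊓ J, fun a b hab hb => ⟨hI a b hab hb.1, hJ a b hab hb.2⟩, ?_⟩
      ext M
      constructor
      · rintro (h | h)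
        · exact (inf_le_left : I ⊓ J ≤ I).trans h
        · exact (inf_le_right : I ⊓ J ≤ J).trans h
      · exact fun h => le_or_le_of_inf_le hI hJ M h)

/-- `IsResidue a M r` says that `a + M = r + M`. -/
def IsResidue [Algebra ℝ A] (a : A) (M : Yosida A) (r : ℝ) : Prop := a - algebraMap ℝ A r ∈ M.1

/-- The relation `R_□` on the Yosida space: `x R_□ y` iff `□ a ∈ x` for all `0 ≤ a ∈ y`. -/
def boxRel (box : A → A) (x y : Yosida A) : Prop := ∀ a ∈ y.1, 0 ≤ a → box a ∈ x.1

end Yosida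

section Frames

variable {X : Type u} [TopologicalSpace X]

/-- `(X, R)` is a compact Hausdorff frame: `X` is a compact Hausdorff space and `R` is a continuous
relation. Here `{x | ∃ y ∈ F, R x y}` is `R⁻¹[F]`. -/
structure IsKHFrame (R : X → X → Prop) : Prop where
  compact : CompactSpace X
  t2 : T2Space X
  isClosed_image : ∀ x, IsClosed {y | R x y}
  isClosed_preimage : ∀ F : Set X, IsClosed F → IsClosed {x | ∃ y ∈ F, R x y}
  isOpen_preimage : ∀ U : Set X, IsOpen U → IsOpen {x | ∃ y ∈ U, R x y}

open Classical in
/-- `(□_R f)(x)` is `inf f(R[x])` if `R[x]` is nonempty, and `1` otherwise. -/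
noncomputable def boxFun (R : X → X → Prop) (f : X → ℝ) (x : X) : ℝ :=
  if ∃ y, R x y then sInf (f '' {y | R x y}) else 1

variable {R : X → X → Prop}

theorem boxFun_of_empty {f : X → ℝ} {x : X} (hx : ¬ ∃ y, R x y) : boxFun R f x = 1 := if_neg hx

theorem isLeast_boxFun (h : IsKHFrame R) {f : X → ℝ} (hf : Continuous f) {x : X}
    (hx : ∃ y, R x y) : IsLeast (f '' {y | R x y}) (boxFun R f x) := by
  have := h.compact
  rw [boxFun, if_pos hx]
  exact ((h.isClosed_image x).isCompact.image hf).isLeast_sInf (Set.Nonempty.image f hx)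

theorem le_boxFun_iff (h : IsKHFrame R) {f : X → ℝ} (hf : Continuous f) {x : X}
    (hx : ∃ y, R x y) (r : ℝ) : r ≤ boxFun R f x ↔ ∀ y, R x y → r ≤ f y := by
  rw [le_isGLB_iff (isLeast_boxFun h hf hx).isGLB, mem_lowerBounds, Set.forall_mem_image]
  rfl

theorem boxFun_lt_iff (h : IsKHFrame R) {f : X → ℝ} (hf : Continuous f) {x : X}
    (hx : ∃ y, R x y) (r : ℝ) : boxFun R f x < r ↔ ∃ y, f y < r ∧ R x y := by
  rw [← not_le, le_boxFun_iff h hf hx]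
  push Not
  exact ⟨fun ⟨y, a, b⟩ => ⟨y, b, a⟩, fun ⟨y, a, b⟩ => ⟨y, b, a⟩⟩

theorem boxFun_eq_iff (h : IsKHFrame R) {f : X → ℝ} (hf : Continuous f) {x : X}
    (hx : ∃ y, R x y) (r : ℝ) :
    boxFun R f x = r ↔ (∃ y, R x y ∧ f y = r) ∧ ∀ y, R x y → r ≤ f y := by
  have hl := isLeast_boxFun h hf hx
  constructor
  · rintro rfl
    exact ⟨hl.1, fun y hy => hl.2 ⟨y, hy, rfl⟩⟩
  · rintro ⟨⟨y, hy, rfl⟩, h2⟩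
    refine hl.unique ⟨⟨y, hy, rfl⟩, ?_⟩
    rintro _ ⟨z, hz, rfl⟩
    exact h2 z hz

theorem continuous_boxFun (h : IsKHFrame R) {f : X → ℝ} (hf : Continuous f) :
    Continuous (boxFun R f) := by
  have hDo : IsOpen {x | ∃ y, R x y} := by simpa using h.isOpen_preimage Set.univ isOpen_univ
  have hDc : IsClosed {x | ∃ y, R x y} := by
    simpa using h.isClosed_preimage Set.univ isClosed_univ
  rw [continuous_iff_continuousAt]
  intro x
  by_cases hx : ∃ y, R x y
  · have hD : {x | ∃ y, R x y} ∈ nhds x := hDo.mem_nhds hx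
    rw [ContinuousAt, tendsto_order]
    constructor
    · intro r hr
      have hc := h.isClosed_preimage {y | f y ≤ r} (isClosed_le hf continuous_const)
      have hxc : x ∈ {x | ∃ y ∈ {y | f y ≤ r}, R x y}ᶜ := by
        rintro ⟨y, hy, hxy⟩
        exact absurd ((isLeast_boxFun h hf hx).2 ⟨y, hxy, rfl⟩) (not_le.2 (lt_of_le_of_lt hy hr))
      filter_upwards [hD, hc.isOpen_compl.mem_nhds hxc] with z hz hzc
      obtain ⟨y, hy, hyz⟩ := (isLeast_boxFun h hf hz).1
      rw [← hyz]
      by_contra hcon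
      exact hzc ⟨y, not_lt.1 hcon, hy⟩
    · intro r hr
      have ho := h.isOpen_preimage {y | f y < r} (isOpen_lt hf continuous_const)
      filter_upwards [hD, ho.mem_nhds ((boxFun_lt_iff h hf hx r).1 hr)] with z hz hzo
      exact (boxFun_lt_iff h hf hz r).2 hzo
  · have hE : {x | ∃ y, R x y}ᶜ ∈ nhds x := hDc.isOpen_compl.mem_nhds hx
    refine (continuousAt_const (y := (1 : ℝ))).congr ?_
    filter_upwards [hE] with z hz
    exact (boxFun_of_empty hz).symm

/-- The operator `□_R` on `C(X, ℝ)`. -/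
noncomputable def boxC (h : IsKHFrame R) (f : C(X, ℝ)) : C(X, ℝ) :=
  ⟨boxFun R f, continuous_boxFun h f.continuous⟩

theorem isModalOperator_boxC (h : IsKHFrame R) : IsModalOperator (boxC h) := by
  have key : ∀ {f : C(X, ℝ)} {x : X} {r : ℝ}, (∃ y, R x y) →
      (∃ y, R x y ∧ f y = r) → (∀ y, R x y → r ≤ f y) → boxC h f x = r :=
    fun {f x r} hx h1 h2 => (boxFun_eq_iff h f.continuous hx r).2 ⟨h1, h2⟩
  have key2 : ∀ (f : C(X, ℝ)) {x : X}, (∃ y, R x y) →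
      (∃ y, R x y ∧ f y = boxC h f x) ∧ (∀ y, R x y → boxC h f x ≤ f y) :=
    fun f x hx => (boxFun_eq_iff h f.continuous hx _).1 rfl
  have keyE : ∀ (f : C(X, ℝ)) {x : X}, (¬ ∃ y, R x y) → boxC h f x = 1 :=
    fun f x hx => boxFun_of_empty hx
  have keyR : ∀ (r : ℝ) {x : X}, (∃ y, R x y) → boxC h (algebraMap ℝ C(X, ℝ) r) x = r := by
    intro r x hx
    obtain ⟨y, hy⟩ := hx
    exact key ⟨y, hy⟩ ⟨y, hy, by simp⟩ (fun z _ => by simp)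
  have key0 : ∀ {x : X}, (∃ y, R x y) → boxC h 0 x = 0 := by
    intro x hx
    simpa using keyR 0 hx
  refine ⟨fun f g => ?_, fun r => ?_, fun f => ?_, fun f r => ?_, fun r f hr => ?_⟩
  all_goals
    ext x
    by_cases hx : ∃ y, R x y
  · obtain ⟨⟨y, hy, hfy⟩, hf⟩ := key2 f hx
    obtain ⟨⟨z, hz, hgz⟩, hg⟩ := key2 g hx
    refine key hx ?_ fun w hw => ?_
    · rcases le_total (boxC h f x) (boxC h g x) with hle | hle
      · refine ⟨y, hy, ?_⟩
        simp only [ContinuousMap.inf_apply]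
        rw [inf_eq_left.2 hle, hfy, inf_eq_left.2 (hle.trans (hg y hy))]
      · refine ⟨z, hz, ?_⟩
        simp only [ContinuousMap.inf_apply]
        rw [inf_eq_right.2 hle, hgz, inf_eq_right.2 (hle.trans (hf z hz))]
    · exact inf_le_inf (hf w hw) (hg w hw)
  · simp [keyE _ hx]
  · simp [keyR r hx, key0 hx]
  · simp [keyE _ hx]
  · obtain ⟨⟨y, hy, hfy⟩, hf⟩ := key2 f hx
    refine key hx ⟨y, hy, ?_⟩ fun w hw => ?_
    · simp [hfy]
    · exact sup_le_sup (hf w hw) le_rfl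
  · simp [keyE _ hx]
  · obtain ⟨⟨y, hy, hfy⟩, hf⟩ := key2 f hx
    refine key hx ⟨y, hy, ?_⟩ fun w hw => ?_
    · simp [hfy, keyR r hx, key0 hx]
    · simpa [keyR r hx, key0 hx] using hf w hw
  · simp [keyE _ hx]
  · obtain ⟨⟨y, hy, hfy⟩, hf⟩ := key2 f hx
    refine key hx ⟨y, hy, ?_⟩ fun w hw => ?_
    · simp [hfy, keyR r hx]
    · simpa [keyR r hx] using mul_le_mul_of_nonneg_left (hf w hw) hr
  · simp [keyE _ hx]

theorem lNorm_eq_norm [CompactSpace X] (f : C(X, ℝ)) : lNorm f = ‖f‖ := by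
  have hiff : ∀ r : ℝ, |f| ≤ algebraMap ℝ C(X, ℝ) r ↔ ∀ x, ‖f x‖ ≤ r := by
    intro r
    rw [ContinuousMap.le_def]
    simp [ContinuousMap.abs_apply, Real.norm_eq_abs]
  unfold lNorm
  rcases isEmpty_or_nonempty X with hX | hX
  · have h1 : {r : ℝ | |f| ≤ algebraMap ℝ C(X, ℝ) r} = Set.univ := by
      ext r
      simp only [hiff, Set.mem_setOf_eq, Set.mem_univ, iff_true]
      exact fun x => isEmptyElim x
    rw [h1, Real.sInf_univ, Subsingleton.elim f 0, norm_zero]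
  · refine IsLeast.csInf_eq ⟨(hiff _).2 f.norm_coe_le_norm, fun r hr => ?_⟩
    have hr' := (hiff r).1 hr
    have hr0 : 0 ≤ r := (norm_nonneg _).trans (hr' (Classical.arbitrary X))
    exact (ContinuousMap.norm_le f hr0).2 hr'

theorem uniformlyComplete_continuousMap [CompactSpace X] : UniformlyComplete C(X, ℝ) := by
  intro s hs
  simp only [lNorm_eq_norm, ← dist_eq_norm] at hs ⊢
  obtain ⟨a, ha⟩ := cauchySeq_tendsto_of_complete (Metric.cauchySeq_iff.2 hs)
  exact ⟨a, Metric.tendsto_atTop.1 ha⟩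

theorem isBAL_continuousMap [CompactSpace X] : IsBAL C(X, ℝ) where
  zero_le_one := by
    rw [ContinuousMap.le_def]; intro x; simp
  add_le_add_left f g hfg k := by
    rw [ContinuousMap.le_def] at hfg ⊢; intro x; simpa using hfg x
  mul_le_mul_of_nonneg_left k hk f g hfg := by
    rw [ContinuousMap.le_def] at hfg hk ⊢
    intro x
    exact mul_le_mul_of_nonneg_left (hfg x) (hk x)
  mul_le_mul_of_nonneg_right k hk f g hfg := by
    rw [ContinuousMap.le_def] at hfg hk ⊢
    intro x
    exact mul_le_mul_of_nonneg_right (hfg x) (hk x)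
  smul_nonneg' r f hr hf := by
    rw [ContinuousMap.le_def] at hf ⊢
    intro x
    exact mul_nonneg hr (hf x)
  bounded f := by
    obtain ⟨n, hn⟩ := exists_nat_ge ‖f‖
    refine ⟨n, ?_⟩
    rw [ContinuousMap.le_def]
    intro x
    simpa using ((le_abs_self _).trans (f.norm_coe_le_norm x)).trans hn
  archimedean f g h := by
    rw [ContinuousMap.le_def]
    intro x
    by_contra hcon
    obtain ⟨n, hn⟩ := Archimedean.arch (g x + 1) (not_le.1 hcon)
    have := ContinuousMap.le_def.1 (h n) x
    simp only [ContinuousMap.smul_apply] at this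
    linarith

end Frames

end BAL

/-- The objects of the category `mbaℓ`: modal bounded archimedean `ℓ`-algebras `(A, □)`. -/
structure MBAL : Type (u + 1) where
  carrier : Type u
  [commRing : CommRing carrier]
  [lattice : Lattice carrier]
  [algebra : Algebra ℝ carrier]
  [isBAL : IsBAL carrier]
  box : carrier → carrier
  isModal : BAL.IsModalOperator box

namespace MBAL

attribute [instance] commRing lattice algebra isBAL

/-- The morphisms of `mbaℓ`: unital `ℓ`-algebra homomorphisms that preserve `□`. -/
@[ext]
structure Hom (A B : MBAL.{u}) : Type u where
  toAlgHom : A.carrier →ₐ[ℝ] B.carrier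
  map_inf : ∀ a b, toAlgHom (a ⊓ b) = toAlgHom a ⊓ toAlgHom b
  map_sup : ∀ a b, toAlgHom (a ⊔ b) = toAlgHom a ⊔ toAlgHom b
  map_box : ∀ a, toAlgHom (A.box a) = B.box (toAlgHom a)

instance : Category.{u} MBAL.{u} where
  Hom := Hom
  id A := ⟨AlgHom.id ℝ A.carrier, fun _ _ => rfl, fun _ _ => rfl, fun _ => rfl⟩
  comp f g := ⟨g.toAlgHom.comp f.toAlgHom,
    fun a b => by simp [f.map_inf, g.map_inf],
    fun a b => by simp [f.map_sup, g.map_sup],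
    fun a => by simp [f.map_box, g.map_box]⟩

/-- The underlying function of a morphism. -/
def Hom.fn {A B : MBAL.{u}} (f : A ⟶ B) : A.carrier → B.carrier := Hom.toAlgHom f

/-- The property of being uniformly complete. -/
def uniformlyComplete : ObjectProperty MBAL.{u} := fun A => BAL.UniformlyComplete A.carrier

/-- `mubaℓ`: the full subcategory of `mbaℓ` of uniformly complete objects. -/
abbrev MUBAL : Type (u + 1) := (uniformlyComplete.{u}).FullSubcategory

/-- The inclusion functor of `mubaℓ` into `mbaℓ`. -/
abbrev inclusion : MUBAL.{u} ⥤ MBAL.{u} := (uniformlyComplete.{u}).ι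

/-- The object `(C(X, ℝ), □_R)` of `mubaℓ` given by a compact Hausdorff frame `(X, R)`. -/
noncomputable def ofFrame {X : Type u} [TopologicalSpace X] {R : X → X → Prop}
    (h : BAL.IsKHFrame R) : MUBAL.{u} where
  obj :=
    { carrier := C(X, ℝ)
      isBAL := have := h.compact; BAL.isBAL_continuousMap
      box := BAL.boxC h
      isModal := BAL.isModalOperator_boxC h }
  property := have := h.compact; BAL.uniformlyComplete_continuousMap

/-- The Yosida space `Y_A` of `A`. -/
abbrev Y (A : MBAL.{u}) : Type u := BAL.Yosida A.carrier

/-- The relation `R_□` on the Yosida space of `(A, □)`. -/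
abbrev R (A : MBAL.{u}) : A.Y → A.Y → Prop := BAL.boxRel A.box

/-- A morphism `f : A ⟶ B` exhibits `B` as the uniform completion of `A`: `B` is uniformly complete
and `f` is an injective, norm-preserving map with dense image. -/
structure IsUniformCompletion {A B : MBAL.{u}} (f : A ⟶ B) : Prop where
  complete : BAL.UniformlyComplete B.carrier
  injective : Function.Injective (Hom.fn f)
  norm_eq : ∀ a, BAL.lNorm (Hom.fn f a) = BAL.lNorm a
  dense : ∀ (b : B.carrier) (ε : ℝ), 0 < ε → ∃ a, BAL.lNorm (b - Hom.fn f a) < ε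

/-- An element of the algebra `ofFrame h`, seen as the continuous function that it is. -/
def asFun {X : Type u} [TopologicalSpace X] {R : X → X → Prop} (h : BAL.IsKHFrame R)
    (f : (ofFrame h).obj.carrier) : C(X, ℝ) := f

end MBAL

/-! Everything is read off at the points of `Y_A`. A maximal ℓ-ideal `M` is prime for nonnegative
elements, so it contains the positive or the negative part of each element, and a Dedekind cut gives
every element a real residue modulo `M`. Points are therefore the ℓ-homomorphisms `A → ℝ` (`ev`,
`ofHom`). The archimedean axiom says that they determine the order (`nonpos_of_forall_ev`), so `A`
embeds isometrically in `C(Y_A)`, and densely by Stone–Weierstrass. Limits of evaluations along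
ultrafilters are again evaluations, which makes `Y_A` compact.

The identity `□0 · □a = □0` splits the points `x`. If `□0` is nonzero at `x`, every `□a` is `1`
there and `R[x]` is empty. If it is zero, `a ↦ (□a)(x)` preserves meets, real translations and
nonnegative scalings; `x R y` then says `(□a)(x) ≤ a(y)` for all `a`, and compactness produces a `y`
attaining equality for a given `a` (`exists_boxRel`). This gives both the infimum formula and the
openness of `R⁻¹[U]`.

For the reflection, `A → B` induces `Y_B → Y_A` and hence `C(Y_A) → C(Y_B)`, where `C(Y_B) ≅ B` if
`B` is complete. All maps involved are continuous, so compatibility with `□` and uniqueness need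
checking only on the dense image of `A`. -/

namespace BAL

/-! ### Existence of maximal ℓ-ideals. -/

section MaximalIdeals

variable {A : Type u} [CommRing A] [Lattice A]

theorem one_notMem (M : Yosida A) : (1 : A) ∉ M.1 := fun h =>
  M.2.1.2 ((Ideal.eq_top_iff_one _).2 h)

theorem algebraMap_mem_iff [Algebra ℝ A] {M : Yosida A} {r : ℝ} :
    algebraMap ℝ A r ∈ M.1 ↔ r = 0 := by
  refine ⟨fun h => ?_, fun h => by simp [h]⟩
  by_contra hr
  refine one_notMem M ?_
  have := M.1.mul_mem_left (algebraMap ℝ A r⁻¹) h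
  rwa [← map_mul, inv_mul_cancel₀ hr, map_one] at this

theorem IsResidue.unique [Algebra ℝ A] {M : Yosida A} {a : A} {r s : ℝ}
    (hr : IsResidue a M r) (hs : IsResidue a M s) : r = s := by
  have := M.1.sub_mem hs hr
  rw [sub_sub_sub_cancel_left, ← map_sub, algebraMap_mem_iff] at this
  linarith

theorem exists_le_yosida {I : Ideal A} (hI : IsLIdeal I) (hne : I ≠ ⊤) :
    ∃ M : Yosida A, I ≤ M.1 := by
  obtain ⟨M, hIM, hM⟩ := zorn_le_nonempty₀ {J : Ideal A | IsLIdeal J ∧ J ≠ ⊤} (by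
    intro c hc hchain J hJ
    refine ⟨sSup c, ⟨?_, ?_⟩, fun K hK => le_sSup hK⟩
    · intro a b hab hb
      rw [Submodule.mem_sSup_of_directed ⟨J, hJ⟩ hchain.directedOn] at hb ⊢
      obtain ⟨K, hK, hbK⟩ := hb
      exact ⟨K, hK, (hc hK).1 a b hab hbK⟩
    · rw [Ne, Ideal.eq_top_iff_one, Submodule.mem_sSup_of_directed ⟨J, hJ⟩ hchain.directedOn]
      rintro ⟨K, hK, h1⟩
      exact (hc hK).2 ((Ideal.eq_top_iff_one _).2 h1)) I ⟨hI, hne⟩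
  exact ⟨⟨M, hM⟩, hIM⟩

end MaximalIdeals

/-! ### Real residues, and the Yosida space as a compact Hausdorff space. -/

section Residues

variable {A : Type u} [CommRing A] [Lattice A] [Algebra ℝ A] [IsBAL A]

theorem algebraMap_nonneg {r : ℝ} (hr : 0 ≤ r) : 0 ≤ algebraMap ℝ A r := by
  rw [Algebra.algebraMap_eq_smul_one]
  exact IsBAL.smul_nonneg' r 1 hr zero_le_one

theorem algebraMap_monotone : Monotone (algebraMap ℝ A) := fun r s h => by
  rw [← sub_nonneg, ← map_sub]
  exact algebraMap_nonneg (sub_nonneg.2 h)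

theorem smul_mono {r : ℝ} (hr : 0 ≤ r) {a b : A} (h : a ≤ b) : r • a ≤ r • b := by
  rw [← sub_nonneg, ← smul_sub]
  exact IsBAL.smul_nonneg' r _ hr (sub_nonneg.2 h)

theorem exists_le_algebraMap (a : A) : ∃ r : ℝ, 0 < r ∧ a ≤ algebraMap ℝ A r := by
  obtain ⟨n, hn⟩ := IsBAL.bounded a
  refine ⟨n + 1, by positivity, hn.trans ?_⟩
  have : n • (1 : A) = algebraMap ℝ A n := by simp
  rw [this]
  exact algebraMap_monotone (by simp)

/-- If a real `r` bounds both factors, then `a * b` is below both `r • a` and `r • b`, hence below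
`r` times their meet. -/
theorem mul_eq_zero_of_inf_eq_zero {a b : A} (h : a ⊓ b = 0) : a * b = 0 := by
  have ha : 0 ≤ a := h ▸ inf_le_left
  have hb : 0 ≤ b := h ▸ inf_le_right
  obtain ⟨r, hr, har⟩ := exists_le_algebraMap (a ⊔ b)
  have hra := le_sup_left.trans har
  have hrb := le_sup_right.trans har
  have h1 : a * b ≤ r • b := by
    rw [Algebra.smul_def]; exact mul_le_mul_of_nonneg_right hra hb
  have h2 : a * b ≤ r • a := by
    rw [Algebra.smul_def, mul_comm]; exact mul_le_mul_of_nonneg_right hrb ha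
  have h3 : r⁻¹ • (a * b) ≤ 0 := by
    rw [← h]
    refine le_inf ?_ ?_
    · simpa [smul_smul, inv_mul_cancel₀ hr.ne'] using smul_mono (inv_nonneg.2 hr.le) h2
    · simpa [smul_smul, inv_mul_cancel₀ hr.ne'] using smul_mono (inv_nonneg.2 hr.le) h1
  have h4 := smul_mono hr.le h3
  rw [smul_smul, mul_inv_cancel₀ hr.ne', one_smul, smul_zero] at h4
  exact le_antisymm h4 (mul_nonneg ha hb)

theorem posPart_mul_negPart (a : A) : a⁺ * a⁻ = 0 :=
  mul_eq_zero_of_inf_eq_zero (posPart_inf_negPart_eq_zero a)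

variable {M : Yosida A}

theorem mem_of_nonneg_of_le {a b : A} (ha : 0 ≤ a) (hab : a ≤ b) (hb : b ∈ M.1) : a ∈ M.1 :=
  M.2.1.1 a b (by rwa [abs_of_nonneg ha, abs_of_nonneg (ha.trans hab)]) hb

theorem mem_or_mem_of_mul_mem {a b : A} (ha : 0 ≤ a) (hb : 0 ≤ b) (h : a * b ∈ M.1) :
    a ∈ M.1 ∨ b ∈ M.1 := by
  by_contra hcon
  rw [not_or] at hcon
  obtain ⟨m, hm, c, h1⟩ := exists_one_le M hcon.1
  obtain ⟨m', hm', c', h1'⟩ := exists_one_le M hcon.2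
  rw [abs_of_nonneg ha] at h1
  rw [abs_of_nonneg hb] at h1'
  refine one_notMem M (mem_of_nonneg_of_le zero_le_one (one_le_mul_of_one_le_of_one_le h1 h1') ?_)
  have : (m + c * a) * (m' + c' * b) = (m' + c' * b) * m + (c * a) * m' + (c * c') * (a * b) := by
    ring
  rw [this]
  exact M.1.add_mem (M.1.add_mem (M.1.mul_mem_left _ hm) (M.1.mul_mem_left _ hm'))
    (M.1.mul_mem_left _ h)

theorem posPart_mem_or_negPart_mem (a : A) : a⁺ ∈ M.1 ∨ a⁻ ∈ M.1 :=
  mem_or_mem_of_mul_mem (posPart_nonneg a) (negPart_nonneg a)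
    (by rw [posPart_mul_negPart]; exact M.1.zero_mem)

/-- There are no nonzero infinitesimals modulo `M`: if `a ∉ M` then `1 ≤ m + c * |a|` with `c` below
a real `r`, and `ε = 1 / (2r)` would put `1/2` below an element of `M`. -/
theorem mem_of_forall_abs_le {a : A}
    (h : ∀ ε : ℝ, 0 < ε → ∃ m ∈ M.1, |a| ≤ m + algebraMap ℝ A ε) : a ∈ M.1 := by
  by_contra ha
  obtain ⟨m, hm, c, h1⟩ := exists_one_le M ha
  obtain ⟨r, hr, hcr⟩ := exists_le_algebraMap c
  obtain ⟨m', hm', h2⟩ := h ((2 * r)⁻¹) (by positivity)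
  have h3 : (1 : A) ≤ m + algebraMap ℝ A r * (m' + algebraMap ℝ A (2 * r)⁻¹) :=
    h1.trans (add_le_add le_rfl ((mul_le_mul_of_nonneg_right hcr (abs_nonneg a)).trans
      (mul_le_mul_of_nonneg_left h2 (algebraMap_nonneg hr.le))))
  have h4 : algebraMap ℝ A 2⁻¹ ≤ m + algebraMap ℝ A r * m' := by
    have e1 : r * (2 * r)⁻¹ = 2⁻¹ := by field_simp
    have e2 : (1 : A) = algebraMap ℝ A 2⁻¹ + algebraMap ℝ A 2⁻¹ := by
      rw [← map_add, ← map_one (algebraMap ℝ A)]; norm_num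
    rw [mul_add, ← map_mul, e1, ← add_assoc, e2] at h3
    exact le_of_add_le_add_right h3
  have h5 := mem_of_nonneg_of_le (algebraMap_nonneg (by norm_num)) h4
    (M.1.add_mem hm (M.1.mul_mem_left _ hm'))
  rw [algebraMap_mem_iff] at h5
  norm_num at h5

theorem le_algebraMap_of_posPart_mem {a : A} {r s : ℝ} (hr : (a - algebraMap ℝ A r)⁺ ∈ M.1)
    (hs : (a - algebraMap ℝ A s)⁻ ∈ M.1) : s ≤ r := by
  by_contra hcon
  rw [not_le] at hcon
  have h1 : algebraMap ℝ A (s - r) ≤ (a - algebraMap ℝ A r)⁺ + (a - algebraMap ℝ A s)⁻ := by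
    have := add_le_add (le_posPart (a - algebraMap ℝ A r)) (neg_le_negPart (a - algebraMap ℝ A s))
    refine le_trans (le_of_eq ?_) this
    rw [map_sub]; ring
  have h2 := mem_of_nonneg_of_le (algebraMap_nonneg (sub_pos.2 hcon).le) h1 (M.1.add_mem hr hs)
  rw [algebraMap_mem_iff] at h2
  linarith

/-- The residue is the infimum of the reals `s` with `a ≤ s` modulo `M`; it differs from `a` by an
infinitesimal, which lies in `M`. -/
theorem exists_isResidue (a : A) (M : Yosida A) : ∃ r : ℝ, IsResidue a M r := by
  let S : Set ℝ := {s | (a - algebraMap ℝ A s)⁺ ∈ M.1}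
  obtain ⟨n, -, hn⟩ := exists_le_algebraMap a
  obtain ⟨k, -, hk⟩ := exists_le_algebraMap (-a)
  have hne : S.Nonempty := ⟨n, by
    have : (a - algebraMap ℝ A n)⁺ = 0 := posPart_eq_zero.2 (sub_nonpos.2 hn)
    simp [S, this]⟩
  have hbdd : BddBelow S := ⟨-k, fun s hs => le_algebraMap_of_posPart_mem hs (by
    have : (a - algebraMap ℝ A (-k))⁻ = 0 := negPart_eq_zero.2 (by
      rw [map_neg, sub_neg_eq_add]; exact neg_le_iff_add_nonneg'.1 hk)
    rw [this]; exact M.1.zero_mem)⟩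
  refine ⟨sInf S, mem_of_forall_abs_le fun ε hε => ?_⟩
  obtain ⟨s, hs, hsε⟩ := exists_lt_of_csInf_lt hne (lt_add_of_pos_right (sInf S) hε)
  have h2 : (a - algebraMap ℝ A (sInf S - ε))⁻ ∈ M.1 := by
    refine (posPart_mem_or_negPart_mem _).resolve_left fun h => ?_
    have := csInf_le hbdd (show sInf S - ε ∈ S from h)
    linarith
  refine ⟨_, M.1.add_mem hs h2, abs_le'.2 ⟨?_, ?_⟩⟩
  · have h3 := le_posPart (a - algebraMap ℝ A s)
    have h4 := negPart_nonneg (a - algebraMap ℝ A (sInf S - ε))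
    have h5 := algebraMap_monotone (A := A) hsε.le
    calc a - algebraMap ℝ A (sInf S)
        = (a - algebraMap ℝ A s) + 0 + (algebraMap ℝ A s - algebraMap ℝ A (sInf S)) := by ring
      _ ≤ _ := add_le_add (add_le_add h3 h4) (by
          rw [map_add] at h5; exact sub_le_iff_le_add'.2 h5)
  · have h3 := neg_le_negPart (a - algebraMap ℝ A (sInf S - ε))
    have h4 := posPart_nonneg (a - algebraMap ℝ A s)
    calc -(a - algebraMap ℝ A (sInf S))
        = 0 + -(a - algebraMap ℝ A (sInf S - ε)) + algebraMap ℝ A ε := by rw [map_sub]; ring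
      _ ≤ _ := add_le_add (add_le_add h4 h3) le_rfl

/-- The real number that `a` is congruent to modulo the maximal `ℓ`-ideal `M`. -/
noncomputable def residue (M : Yosida A) (a : A) : ℝ := (exists_isResidue a M).choose

theorem residue_spec (M : Yosida A) (a : A) : IsResidue a M (residue M a) :=
  (exists_isResidue a M).choose_spec

theorem residue_eq_iff {a : A} {r : ℝ} : residue M a = r ↔ IsResidue a M r :=
  ⟨fun h => h ▸ residue_spec M a, fun h => (residue_spec M a).unique h⟩

/-- Evaluation at a maximal `ℓ`-ideal `M`, as a homomorphism `A → A / M ≅ ℝ`. -/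
noncomputable def ev (M : Yosida A) : A →ₐ[ℝ] ℝ where
  toFun := residue M
  map_one' := residue_eq_iff.2 (by simp [IsResidue])
  map_zero' := residue_eq_iff.2 (by simp [IsResidue])
  map_mul' a b := residue_eq_iff.2 (by
    have h := M.1.add_mem (M.1.mul_mem_left b (residue_spec M a))
      (M.1.mul_mem_left (algebraMap ℝ A (residue M a)) (residue_spec M b))
    unfold IsResidue
    convert h using 1
    rw [map_mul]; ring)
  map_add' a b := residue_eq_iff.2 (by
    have h := M.1.add_mem (residue_spec M a) (residue_spec M b)
    unfold IsResidue
    convert h using 1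
    rw [map_add]; ring)
  commutes' r := residue_eq_iff.2 (by simp [IsResidue])

theorem ev_eq_iff {a : A} {r : ℝ} : ev M a = r ↔ IsResidue a M r := residue_eq_iff

theorem mem_iff_ev_eq_zero {a : A} : a ∈ M.1 ↔ ev M a = 0 := by
  rw [ev_eq_iff]; simp [IsResidue]

theorem ev_nonneg {a : A} (ha : 0 ≤ a) : 0 ≤ ev M a := by
  by_contra hcon
  rw [not_le] at hcon
  have h := ev_eq_iff.1 (rfl : ev M a = ev M a)
  have h1 : algebraMap ℝ A (-ev M a) ∈ M.1 :=
    mem_of_nonneg_of_le (algebraMap_nonneg (by linarith)) (by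
      rw [map_neg, sub_eq_add_neg]; exact le_add_of_nonneg_left ha) h
  rw [algebraMap_mem_iff] at h1
  linarith

theorem ev_mono {a b : A} (h : a ≤ b) : ev M a ≤ ev M b := by
  have := ev_nonneg (M := M) (sub_nonneg.2 h)
  rwa [map_sub, sub_nonneg] at this

theorem ev_posPart (a : A) : ev M a⁺ = ev M a ⊔ 0 := by
  have h : ev M a = ev M a⁺ - ev M a⁻ := by rw [← map_sub, posPart_sub_negPart]
  rcases posPart_mem_or_negPart_mem (M := M) a with h1 | h1 <;> rw [mem_iff_ev_eq_zero] at h1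
  · rw [h, h1, sup_eq_right.2]
    linarith [ev_nonneg (M := M) (negPart_nonneg a)]
  · rw [h, h1, sub_zero, sup_eq_left.2]
    exact ev_nonneg (posPart_nonneg a)

theorem ev_sup (a b : A) : ev M (a ⊔ b) = ev M a ⊔ ev M b := by
  have h : a ⊔ b = (a - b)⁺ + b := by
    rw [posPart_def, sup_add]; simp
  rw [h, map_add, ev_posPart, map_sub, sup_add]
  simp

theorem ev_inf (a b : A) : ev M (a ⊓ b) = ev M a ⊓ ev M b := by
  have h : a ⊓ b = -(-a ⊔ -b) := by rw [neg_sup, neg_neg, neg_neg]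
  rw [h, map_neg, ev_sup, map_neg, map_neg, neg_sup, neg_neg, neg_neg]

theorem ev_abs (a : A) : ev M |a| = |ev M a| := by
  rw [abs, ev_sup, map_neg]; rfl

theorem le_ev_iff {a : A} {r : ℝ} : r ≤ ev M a ↔ (algebraMap ℝ A r - a)⁺ ∈ M.1 := by
  rw [mem_iff_ev_eq_zero, ev_posPart, sup_eq_right, map_sub, AlgHom.commutes, sub_nonpos]
  rfl

theorem yosida_ext {M N : Yosida A} (h : ∀ a, ev M a = ev N a) : M = N :=
  Subtype.ext (Ideal.ext fun a => by rw [mem_iff_ev_eq_zero, mem_iff_ev_eq_zero, h])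

/-- The kernel of an `ℓ`-algebra homomorphism `A → ℝ`, as a maximal `ℓ`-ideal. -/
def ofHom (φ : A →ₐ[ℝ] ℝ) (hφ : ∀ a, φ |a| = |φ a|) : Yosida A :=
  ⟨RingHom.ker φ, by
    have hpos : ∀ a, 0 ≤ a → 0 ≤ φ a := fun a ha => by
      rw [← abs_of_nonneg ha, hφ]; exact abs_nonneg _
    refine ⟨⟨fun a b hab hb => ?_, RingHom.ker_ne_top _⟩, ?_⟩
    · rw [RingHom.mem_ker] at hb ⊢
      have h1 := hpos _ (sub_nonneg.2 hab)
      rw [map_sub, hφ, hφ, hb, abs_zero, zero_sub] at h1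
      exact abs_nonpos_iff.1 (by linarith)
    · rintro J ⟨-, hJ⟩ hle a ha
      rw [RingHom.mem_ker]
      by_contra hne
      refine hJ ((Ideal.eq_top_iff_one _).2 ?_)
      -- An ideal above the kernel containing `a` with `φ a ≠ 0` contains the nonzero real `φ a`.
      have h1 : a - algebraMap ℝ A (φ a) ∈ J := hle (by simp [RingHom.mem_ker])
      have h2 := J.mul_mem_left (algebraMap ℝ A (φ a)⁻¹) (J.sub_mem ha h1)
      rwa [sub_sub_cancel, ← map_mul, inv_mul_cancel₀ hne, map_one] at h2⟩

theorem ev_ofHom (φ : A →ₐ[ℝ] ℝ) (hφ : ∀ a, φ |a| = |φ a|) (a : A) : ev (ofHom φ hφ) a = φ a :=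
  ev_eq_iff.2 (by simp [IsResidue, ofHom, RingHom.mem_ker])

/-- The `ℓ`-ideal generated by an element `b`. -/
def principal (b : A) : Ideal A where
  carrier := {x | ∃ r : ℝ, 0 ≤ r ∧ |x| ≤ r • |b|}
  zero_mem' := ⟨0, le_rfl, by simp⟩
  add_mem' := by
    rintro x y ⟨r, hr, hx⟩ ⟨s, hs, hy⟩
    exact ⟨r + s, add_nonneg hr hs, (abs_add_le x y).trans (by rw [add_smul]; exact add_le_add hx hy)⟩
  smul_mem' := by
    rintro c x ⟨r, hr, hx⟩
    obtain ⟨s, hs, hcs⟩ := exists_le_algebraMap |c|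
    refine ⟨s * r, mul_nonneg hs.le hr, ?_⟩
    have key : ∀ d : A, |d| ≤ algebraMap ℝ A s → d * x ≤ s • |x| := by
      intro d hd
      obtain ⟨h1, h2⟩ := abs_le'.1 hd
      -- The right-hand side equals twice `s • |x| - d * x`.
      have h3 : 0 ≤ (algebraMap ℝ A s - d) * (|x| + x) +
          (algebraMap ℝ A s + d) * (|x| - x) := by
        refine add_nonneg (mul_nonneg (sub_nonneg.2 h1) ?_) (mul_nonneg ?_ ?_)
        · exact neg_le_iff_add_nonneg.1 (neg_le_abs x)
        · exact (neg_le_iff_add_nonneg.1 h2)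
        · exact sub_nonneg.2 (le_abs_self x)
      have h4 : 0 ≤ 2 • (s • |x| - d * x) := by
        rw [two_nsmul, Algebra.smul_def]; convert h3 using 1; ring
      exact sub_nonneg.1 (nsmul_two_semiclosed h4)
    have h5 : |c • x| ≤ s • |x| := by
      refine abs_le'.2 ⟨key c hcs, ?_⟩
      have := key (-c) (by rwa [abs_neg])
      rwa [neg_mul] at this
    exact h5.trans (by rw [mul_smul]; exact smul_mono hs.le hx)

theorem isLIdeal_principal (b : A) : IsLIdeal (principal b) :=
  fun _ _ hxy ⟨r, hr, h⟩ => ⟨r, hr, hxy.trans h⟩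

theorem self_mem_principal (b : A) : b ∈ principal b := ⟨1, zero_le_one, by simp⟩

theorem mem_zeroSet_principal {b : A} : M ∈ zeroSet (principal b) ↔ b ∈ M.1 := by
  refine ⟨fun h => h (self_mem_principal b), fun hb x ⟨r, hr, hx⟩ => ?_⟩
  refine M.2.1.1 x (r • |b|) (hx.trans (le_abs_self _)) ?_
  rw [Algebra.smul_def]
  exact M.1.mul_mem_left _ (abs_mem M.2.1.1 hb)

/-- The archimedean axiom reduces the claim to `c = n • a - 1 ≤ 0`. If `c⁻` generated a proper
ℓ-ideal, it would vanish at some point, where then `n • a ≥ 1`. So `1 ≤ r • c⁻` for some `r`, and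
multiplying by `c⁺` kills `c⁺`. -/
theorem nonpos_of_forall_ev {a : A} (h : ∀ M : Yosida A, ev M a ≤ 0) : a ≤ 0 := by
  refine IsBAL.archimedean a 1 fun n => ?_
  let c : A := n • a - 1
  by_cases hd : principal c⁻ = ⊤
  · obtain ⟨r, hr, h1⟩ : (1 : A) ∈ principal c⁻ := by rw [hd]; trivial
    rw [abs_of_nonneg zero_le_one, abs_of_nonneg (negPart_nonneg c)] at h1
    have h2 : c⁺ ≤ r • (c⁻ * c⁺) := by
      simpa using mul_le_mul_of_nonneg_right h1 (posPart_nonneg c)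
    rw [mul_comm, posPart_mul_negPart, smul_zero] at h2
    exact sub_nonpos.1 ((le_posPart c).trans h2)
  · obtain ⟨M, hM⟩ := exists_le_yosida (isLIdeal_principal _) hd
    have h1 := mem_iff_ev_eq_zero.1 (hM (self_mem_principal _))
    have h2 := ev_mono (M := M) (neg_le_negPart c)
    have h3 := mul_nonpos_of_nonneg_of_nonpos (Nat.cast_nonneg (α := ℝ) n) (h M)
    rw [h1, map_neg, map_sub, map_nsmul, map_one, nsmul_eq_mul] at h2
    linarith

theorem le_of_forall_ev {a b : A} (h : ∀ M : Yosida A, ev M a ≤ ev M b) : a ≤ b := by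
  rw [← sub_nonpos]
  refine nonpos_of_forall_ev fun M => ?_
  rw [map_sub, sub_nonpos]
  exact h M

theorem isClosed_iff_zeroSet {F : Set (Yosida A)} :
    IsClosed F ↔ ∃ I : Ideal A, IsLIdeal I ∧ F = zeroSet I := by
  rw [← isOpen_compl_iff]
  change Fᶜᶜ ∈ {F | ∃ I : Ideal A, IsLIdeal I ∧ F = zeroSet I} ↔ _
  rw [compl_compl]
  rfl

theorem isClosed_zeroSet {I : Ideal A} (hI : IsLIdeal I) : IsClosed (zeroSet I) :=
  isClosed_iff_zeroSet.2 ⟨I, hI, rfl⟩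

theorem isClosed_le_ev (a : A) (r : ℝ) : IsClosed {M : Yosida A | r ≤ ev M a} := by
  have : {M : Yosida A | r ≤ ev M a} = zeroSet (principal (algebraMap ℝ A r - a)⁺) := by
    ext M
    rw [mem_zeroSet_principal, ← le_ev_iff]; rfl
  rw [this]
  exact isClosed_zeroSet (isLIdeal_principal _)

theorem continuous_ev (a : A) : Continuous fun M : Yosida A => ev M a := by
  refine OrderTopology.continuous_iff.2 fun r => ⟨?_, ?_⟩
  · have h := (isClosed_le_ev (-a) (-r)).isOpen_compl
    convert h using 1
    ext M; simp
  · have h := (isClosed_le_ev a r).isOpen_compl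
    convert h using 1
    ext M; simp

instance : T2Space (Yosida A) :=
  T2Space.of_injective_continuous (f := fun M (a : A) => ev M a)
    (fun _ _ h => yosida_ext (congrFun h)) (continuous_pi continuous_ev)

/-- Each `a` is bounded, so its values converge along an ultrafilter; the limits form an
ℓ-homomorphism to `ℝ`, whose kernel is the limit point. -/
instance : CompactSpace (Yosida A) := by
  refine ⟨isCompact_iff_ultrafilter_le_nhds.2 fun U _ => ?_⟩
  have hlim : ∀ a : A, ∃ r : ℝ, Filter.Tendsto (fun M : Yosida A => ev M a) U (nhds r) := by
    intro a
    obtain ⟨k, -, hk⟩ := exists_le_algebraMap |a|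
    have hk' : ∀ M : Yosida A, ev M a ∈ Set.Icc (-k) k := fun M => by
      have := ev_mono (M := M) hk
      rw [ev_abs, AlgHom.commutes] at this
      exact abs_le.1 this
    obtain ⟨r, -, hr⟩ := isCompact_iff_ultrafilter_le_nhds.1 (isCompact_Icc (a := -k) (b := k))
      (U.map fun M => ev M a) (by
        rw [Filter.le_principal_iff]
        exact Filter.mem_map.2 (Filter.Eventually.of_forall hk'))
    exact ⟨r, hr⟩
  choose lim hlim using hlim
  let φ : A →ₐ[ℝ] ℝ :=
    { toFun := lim
      map_one' := tendsto_nhds_unique (hlim 1) (by simp)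
      map_zero' := tendsto_nhds_unique (hlim 0) (by simp)
      map_mul' := fun a b => tendsto_nhds_unique (hlim _) (by simpa using (hlim a).mul (hlim b))
      map_add' := fun a b => tendsto_nhds_unique (hlim _) (by simpa using (hlim a).add (hlim b))
      commutes' := fun r => tendsto_nhds_unique (hlim _) (by simp) }
  have hφ : ∀ a, φ |a| = |φ a| := fun a =>
    tendsto_nhds_unique (hlim |a|) ((hlim a).abs.congr fun M => (ev_abs a).symm)
  refine ⟨ofHom φ hφ, trivial, le_nhds_iff.2 fun O hO hOo => ?_⟩
  by_contra hU
  obtain ⟨I, hI, hOI⟩ := isClosed_iff_zeroSet.1 hOo.isClosed_compl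
  have hUc : zeroSet I ∈ U := hOI ▸ Ultrafilter.compl_mem_iff_notMem.2 hU
  have : ofHom φ hφ ∈ Oᶜ := by
    rw [hOI]
    intro a ha
    rw [mem_iff_ev_eq_zero, ev_ofHom]
    -- Each `a ∈ I` vanishes on `zeroSet I`, a member of the ultrafilter, so its limit is zero.
    refine tendsto_nhds_unique (hlim a) (Filter.Tendsto.congr' ?_ tendsto_const_nhds)
    filter_upwards [hUc] with M hM
    exact (mem_iff_ev_eq_zero.1 (hM ha)).symm
  exact this hO

end Residues

end BAL

namespace BAL

/-! ### The modal operator as an infimum over the relation. -/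

section Modal

variable {A : Type u} [CommRing A] [Lattice A] [Algebra ℝ A] {box : A → A}
  {x y : Yosida A}

namespace IsModalOperator

theorem monotone (hb : IsModalOperator box) : Monotone box := fun a b h => by
  rw [← inf_eq_left, ← hb.map_inf, inf_eq_left.2 h]

theorem box_nonneg (hb : IsModalOperator box) {a : A} (ha : 0 ≤ a) : 0 ≤ box a := by
  have := hb.map_pos a
  rw [sup_eq_left.2 ha] at this
  exact this ▸ le_sup_right

/-- The scaling axiom at the scalar `0`. It is the source of the dichotomy between points with and
without successors. -/
theorem box_zero_mul (hb : IsModalOperator box) (a : A) : box 0 * box a = box 0 := by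
  have := hb.map_smul 0 a le_rfl
  rw [zero_smul, map_zero] at this
  exact this.symm

variable [IsBAL A]

theorem ev_box_eq_one (hb : IsModalOperator box) (hx : ev x (box 0) ≠ 0) (a : A) :
    ev x (box a) = 1 := by
  have := congrArg (ev x) (hb.box_zero_mul a)
  rw [map_mul] at this
  exact mul_left_cancel₀ hx (this.trans (mul_one _).symm)

theorem ev_box_real (hb : IsModalOperator box) (hx : ev x (box 0) = 0) (r : ℝ) :
    ev x (box (algebraMap ℝ A r)) = r := by
  rw [hb.map_real, map_add, map_mul, hx, AlgHom.commutes]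
  simp

theorem ev_box_add_real (hb : IsModalOperator box) (hx : ev x (box 0) = 0) (a : A) (r : ℝ) :
    ev x (box (a + algebraMap ℝ A r)) = ev x (box a) + r := by
  rw [hb.map_add_real, map_sub, map_add, hb.ev_box_real hx, hx, sub_zero]

theorem ev_box_smul (hb : IsModalOperator box) (hx : ev x (box 0) = 0) {r : ℝ} (hr : 0 ≤ r)
    (a : A) : ev x (box (r • a)) = r * ev x (box a) := by
  rw [hb.map_smul r a hr, map_mul, hb.ev_box_real hx]

/-- The positive part of `a - ev y a` lies in `y`; where `□0` vanishes, `□` commutes with this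
translation and with positive parts. -/
theorem boxRel_iff (hb : IsModalOperator box) :
    boxRel box x y ↔ ∀ a, ev x (box a) ≤ ev y a := by
  constructor
  · intro h a
    have h0 : ev x (box 0) = 0 := mem_iff_ev_eq_zero.1 (h 0 y.1.zero_mem le_rfl)
    have h1 : (a + algebraMap ℝ A (-ev y a)) ⊔ 0 ∈ y.1 := by
      rw [mem_iff_ev_eq_zero, ev_sup, map_add, AlgHom.commutes]
      simp
    have h2 := mem_iff_ev_eq_zero.1 (h _ h1 le_sup_right)
    rw [hb.map_pos, ev_sup, map_zero, sup_eq_right, hb.ev_box_add_real h0] at h2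
    linarith
  · intro h a ha ha0
    rw [mem_iff_ev_eq_zero] at ha ⊢
    exact le_antisymm (ha ▸ h a) (ev_nonneg (hb.box_nonneg ha0))

/-- The nonemptiness input for the compactness argument. Otherwise `a > 0` or `b < 0` at every
point, by a uniform margin `δ`; then `(k • b + δ) ⊓ δ ≤ a` for large `k`, and `□` at `x` turns this
into `δ ≤ 0`. -/
theorem exists_ev_le (hb : IsModalOperator box) (hx : ev x (box 0) = 0) {a b : A}
    (ha : ev x (box a) = 0) (hb0 : ev x (box b) = 0) :
    ∃ y : Yosida A, ev y a ≤ 0 ∧ 0 ≤ ev y b := by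
  by_contra! hcon
  have hpos : ∀ y : Yosida A, 0 < ev y (a ⊔ -b) := fun y => by
    rw [ev_sup, map_neg, lt_sup_iff]
    rcases lt_or_ge 0 (ev y a) with h | h
    · exact Or.inl h
    · exact Or.inr (neg_pos.2 (hcon y h))
  obtain ⟨δ, hδ, hle⟩ : ∃ δ : ℝ, 0 < δ ∧ ∀ y : Yosida A, δ ≤ ev y (a ⊔ -b) := by
    obtain ⟨y, -, hy⟩ := isCompact_univ.exists_isMinOn ⟨x, Set.mem_univ x⟩
      (continuous_ev (a ⊔ -b)).continuousOn
    exact ⟨_, hpos y, fun z => hy (Set.mem_univ z)⟩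
  obtain ⟨n, hn0, hn⟩ := exists_le_algebraMap (-a)
  -- With this `k`, wherever `b ≤ -δ` one has `k b + δ ≤ -n ≤ a`.
  let k : ℝ := n / δ + 1
  have hk : 0 ≤ k := by positivity
  have hkδ : k * δ = n + δ := by simp only [k]; field_simp
  have hab : (k • b + algebraMap ℝ A δ) ⊓ algebraMap ℝ A δ ≤ a := by
    refine le_of_forall_ev fun y => ?_
    have h1 := hle y
    rw [ev_sup, map_neg, le_sup_iff] at h1
    rw [ev_inf, map_add, _root_.map_smul, AlgHom.commutes, inf_le_iff]
    rcases h1 with h1 | h1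
    · exact Or.inr h1
    · refine Or.inl ?_
      have h2 := ev_mono (M := y) hn
      rw [map_neg, AlgHom.commutes] at h2
      have h3 : k * ev y b ≤ k * (-δ) := mul_le_mul_of_nonneg_left (by linarith) hk
      simp only [smul_eq_mul, Algebra.algebraMap_self, RingHom.id_apply] at h2 ⊢
      linarith
  have := ev_mono (M := x) (hb.monotone hab)
  rw [hb.map_inf, ev_inf, hb.ev_box_add_real hx, hb.ev_box_smul hx hk, hb.ev_box_real hx, ha, hb0,
    mul_zero, zero_add, inf_idem] at this
  exact absurd hδ (not_lt.2 this)

/-- Subtracting the constant `ev x (box c)` from `c` makes its box vanish at `x`. The closed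
conditions on `y` are then directed, since `□` preserves meets, and each is satisfiable, so
compactness gives a common solution. -/
theorem exists_boxRel (hb : IsModalOperator box) (hx : ev x (box 0) = 0) (a : A) :
    ∃ y, boxRel box x y ∧ ev y a = ev x (box a) := by
  suffices h : ∃ y : Yosida A, ev y a ≤ ev x (box a) ∧ ∀ b, ev x (box b) ≤ ev y b by
    obtain ⟨y, hya, hy⟩ := h
    exact ⟨y, hb.boxRel_iff.2 hy, le_antisymm hya (hy a)⟩
  let norm (c : A) : A := c + algebraMap ℝ A (-ev x (box c))
  have hnorm : ∀ c, ev x (box (norm c)) = 0 := fun c => by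
    rw [hb.ev_box_add_real hx, add_neg_cancel]
  have hevn : ∀ (c : A) (y : Yosida A), ev y (norm c) = ev y c - ev x (box c) := fun c y => by
    rw [map_add, AlgHom.commutes, Algebra.algebraMap_self, RingHom.id_apply, sub_eq_add_neg]
  let K (b : {b : A // ev x (box b) = 0}) : Set (Yosida A) :=
    {y | ev y (norm a) ≤ 0} ∩ {y | 0 ≤ ev y b.1}
  have hKc : ∀ b, IsClosed (K b) := fun b =>
    (isClosed_le (continuous_ev _) continuous_const).inter (isClosed_le_ev _ _)
  have : Nonempty {b : A // ev x (box b) = 0} := ⟨⟨0, hx⟩⟩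
  obtain ⟨y, hy⟩ := IsCompact.nonempty_iInter_of_directed_nonempty_isCompact_isClosed K
    (fun b c => ⟨⟨b.1 ⊓ c.1, by rw [hb.map_inf, ev_inf, b.2, c.2, inf_idem]⟩,
      fun y hy => ⟨hy.1, hy.2.trans (ev_mono inf_le_left)⟩,
      fun y hy => ⟨hy.1, hy.2.trans (ev_mono inf_le_right)⟩⟩)
    (fun b => hb.exists_ev_le hx (hnorm a) b.2)
    (fun b => (hKc b).isCompact) hKc
  rw [Set.mem_iInter] at hy
  refine ⟨y, ?_, fun b => ?_⟩
  · have := (hy ⟨0, hx⟩).1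
    rwa [Set.mem_ofPred_eq, hevn, sub_nonpos] at this
  · have := (hy ⟨norm b, hnorm b⟩).2
    rwa [Set.mem_ofPred_eq, hevn, sub_nonneg] at this

theorem exists_boxRel_iff (hb : IsModalOperator box) :
    (∃ y, boxRel box x y) ↔ ev x (box 0) = 0 := by
  refine ⟨fun ⟨y, hy⟩ => ?_, fun hx => ?_⟩
  · exact mem_iff_ev_eq_zero.1 (hy 0 y.1.zero_mem le_rfl)
  · obtain ⟨y, hy, -⟩ := hb.exists_boxRel hx 0
    exact ⟨y, hy⟩

theorem isClosed_boxRel (hb : IsModalOperator box) :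
    IsClosed {p : Yosida A × Yosida A | boxRel box p.1 p.2} := by
  simp only [hb.boxRel_iff, Set.ofPred_forall]
  exact isClosed_iInter fun a => isClosed_le ((continuous_ev _).comp continuous_fst)
    ((continuous_ev _).comp continuous_snd)

theorem isKHFrame (hb : IsModalOperator box) : IsKHFrame (boxRel box) where
  compact := inferInstance
  t2 := inferInstance
  isClosed_image x := hb.isClosed_boxRel.preimage (Continuous.prodMk_right x)
  isClosed_preimage F hF := by
    have h := isClosedMap_fst_of_compactSpace _
      (hb.isClosed_boxRel.inter (hF.preimage continuous_snd))
    convert h using 1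
    ext x
    constructor
    · rintro ⟨y, hy, hxy⟩
      exact ⟨(x, y), ⟨hxy, hy⟩, rfl⟩
    · rintro ⟨⟨_, y⟩, ⟨hxy, hy⟩, rfl⟩
      exact ⟨y, hy, hxy⟩
  isOpen_preimage U hU := by
    rw [isOpen_iff_mem_nhds]
    rintro x ⟨y, hy, hxy⟩
    obtain ⟨I, -, hUI⟩ := isClosed_iff_zeroSet.1 hU.isClosed_compl
    have hyI : y ∉ zeroSet I := by rw [← hUI]; exact fun h => h hy
    obtain ⟨b, hbI, hby⟩ := Set.not_subset.1 hyI
    -- As `b ∈ I` and `b ∉ y`, `-|b|` is negative at `y` and zero off `U`. So negativity of its box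
    -- is an open condition that forces a successor in `U`.
    have hlt : ev x (box (-|b|)) < 0 := by
      refine (hb.boxRel_iff.1 hxy _).trans_lt ?_
      rw [map_neg, ev_abs, neg_lt_zero, abs_pos]
      exact fun h => hby (mem_iff_ev_eq_zero.2 h)
    filter_upwards [(isOpen_lt (continuous_ev (box (-|b|))) continuous_const).mem_nhds hlt]
      with z hz
    have hz0 : ev z (box 0) = 0 := by
      by_contra h
      rw [hb.ev_box_eq_one h] at hz
      linarith
    obtain ⟨w, hzw, hw⟩ := hb.exists_boxRel hz0 (-|b|)
    refine ⟨w, ?_, hzw⟩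
    by_contra hwU
    have hwI : w ∈ zeroSet I := hUI ▸ hwU
    rw [map_neg, ev_abs, mem_iff_ev_eq_zero.1 (hwI hbI)] at hw
    rw [← hw] at hz
    simp at hz

theorem ev_box (hb : IsModalOperator box) (a : A) (x : Yosida A) :
    ev x (box a) = boxFun (boxRel box) (fun y => ev y a) x := by
  by_cases hx : ev x (box 0) = 0
  · refine ((boxFun_eq_iff hb.isKHFrame (continuous_ev a) (hb.exists_boxRel_iff.2 hx) _).2
      ⟨hb.exists_boxRel hx a, fun y hy => hb.boxRel_iff.1 hy a⟩).symm
  · rw [boxFun_of_empty (fun h => hx (hb.exists_boxRel_iff.1 h)), hb.ev_box_eq_one hx]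

end IsModalOperator

end Modal

/-! ### The Yosida representation as uniform completion. -/

section Completion

variable {A : Type u} [CommRing A] [Lattice A] [Algebra ℝ A] [IsBAL A]

/-- An element of `A` as a continuous function on the Yosida space. -/
noncomputable def yosidaMap (A : Type u) [CommRing A] [Lattice A] [Algebra ℝ A] [IsBAL A] :
    A →ₐ[ℝ] C(Yosida A, ℝ) where
  toFun a := ⟨fun M => ev M a, continuous_ev a⟩
  map_one' := by ext M; exact map_one (ev M)
  map_zero' := by ext M; exact map_zero (ev M)
  map_mul' a b := by ext M; exact map_mul (ev M) a b
  map_add' a b := by ext M; exact map_add (ev M) a b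
  commutes' r := by ext M; exact (ev M).commutes r

theorem IsModalOperator.yosidaMap_box {box : A → A} (hb : IsModalOperator box) (a : A) :
    yosidaMap A (box a) = boxC hb.isKHFrame (yosidaMap A a) := by
  ext M; exact hb.ev_box a M

theorem yosidaMap_le_iff {a b : A} : yosidaMap A a ≤ yosidaMap A b ↔ a ≤ b :=
  ⟨fun h => le_of_forall_ev fun M => h M, fun h _ => ev_mono h⟩

theorem yosidaMap_injective : Function.Injective (yosidaMap A) := fun _ _ h =>
  le_antisymm (yosidaMap_le_iff.1 h.le) (yosidaMap_le_iff.1 h.ge)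

theorem yosidaMap_inf (a b : A) : yosidaMap A (a ⊓ b) = yosidaMap A a ⊓ yosidaMap A b := by
  ext M; exact ev_inf a b

theorem yosidaMap_sup (a b : A) : yosidaMap A (a ⊔ b) = yosidaMap A a ⊔ yosidaMap A b := by
  ext M; exact ev_sup a b

theorem lNorm_yosidaMap (a : A) : lNorm (yosidaMap A a) = lNorm a := by
  have h : |yosidaMap A a| = yosidaMap A |a| := by rw [abs, abs, yosidaMap_sup, map_neg]
  unfold lNorm
  congr 1
  ext r
  rw [Set.mem_ofPred_eq, Set.mem_ofPred_eq, h, ← (yosidaMap A).commutes r, yosidaMap_le_iff]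

theorem norm_yosidaMap (a : A) : ‖yosidaMap A a‖ = lNorm a := by
  rw [← lNorm_eq_norm, lNorm_yosidaMap]

/-- Stone–Weierstrass: a maximal ℓ-ideal is determined by its residues, so the image separates
points. -/
theorem denseRange_yosidaMap : DenseRange (yosidaMap A) := by
  have h := ContinuousMap.subalgebra_topologicalClosure_eq_top_of_separatesPoints
    (yosidaMap A).range (by
      intro M N hMN
      by_contra hcon
      refine hMN (yosida_ext fun a => ?_)
      by_contra hne
      exact hcon ⟨_, ⟨yosidaMap A a, ⟨a, rfl⟩, rfl⟩, hne⟩)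
  rw [denseRange_iff_closure_range, ← AlgHom.coe_range, ← Subalgebra.topologicalClosure_coe, h]
  rfl

theorem exists_lNorm_sub_yosidaMap_lt (f : C(Yosida A, ℝ)) {ε : ℝ} (hε : 0 < ε) :
    ∃ a, lNorm (f - yosidaMap A a) < ε := by
  simpa only [lNorm_eq_norm, dist_eq_norm] using denseRange_yosidaMap.exists_dist_lt f hε

/-- The image of an isometric embedding of a complete algebra is closed, and here it is dense. -/
theorem UniformlyComplete.yosidaMap_surjective (hA : UniformlyComplete A) :
    Function.Surjective (yosidaMap A) := by
  intro f
  obtain ⟨u, hu, hlim⟩ := mem_closure_iff_seq_limit.1 (denseRange_yosidaMap f)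
  choose s hs using hu
  obtain ⟨a, ha⟩ := hA s (by
    simp only [← norm_yosidaMap, map_sub, hs, ← dist_eq_norm]
    exact Metric.cauchySeq_iff.1 hlim.cauchySeq)
  simp only [← norm_yosidaMap, map_sub, hs, ← dist_eq_norm] at ha
  exact ⟨a, tendsto_nhds_unique (Metric.tendsto_atTop.2 ha) hlim⟩

end Completion

/-! ### Functoriality and extension of homomorphisms. -/

section Functoriality

variable {X : Type u} [TopologicalSpace X] {R : X → X → Prop}

theorem boxFun_le_add (h : IsKHFrame R) {f g : C(X, ℝ)} {ε : ℝ} (hε : 0 ≤ ε)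
    (hfg : ∀ x, f x ≤ g x + ε) (x : X) : boxFun R f x ≤ boxFun R g x + ε := by
  by_cases hx : ∃ y, R x y
  · obtain ⟨y, hy, hgy⟩ := (isLeast_boxFun h g.continuous hx).1
    exact ((isLeast_boxFun h f.continuous hx).2 ⟨y, hy, rfl⟩).trans (hgy ▸ hfg y)
  · rw [boxFun_of_empty hx, boxFun_of_empty hx]
    linarith

theorem continuous_boxC (h : IsKHFrame R) : Continuous (boxC h) := by
  have := h.compact
  refine (LipschitzWith.of_dist_le_mul (K := 1) fun f g => ?_).continuous
  rw [NNReal.coe_one, one_mul, ContinuousMap.dist_le dist_nonneg]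
  intro x
  have hfg : ∀ f g : C(X, ℝ), ∀ x, f x ≤ g x + dist f g := fun f g x => by
    have := (le_abs_self _).trans (ContinuousMap.dist_apply_le_dist (f := f) (g := g) x)
    linarith
  rw [Real.dist_eq, abs_sub_le_iff]
  have h1 := boxFun_le_add h dist_nonneg (hfg f g) x
  have h2 := boxFun_le_add h dist_nonneg (hfg g f) x
  rw [dist_comm] at h2
  exact ⟨sub_le_iff_le_add'.2 h1, sub_le_iff_le_add'.2 h2⟩

variable {A B : Type u} [CommRing A] [Lattice A] [Algebra ℝ A] [IsBAL A]
  [CommRing B] [Lattice B] [Algebra ℝ B] [IsBAL B]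

/-- The map of Yosida spaces induced by an `ℓ`-algebra homomorphism. -/
noncomputable def comap (f : A →ₐ[ℝ] B) (hf : ∀ a b, f (a ⊔ b) = f a ⊔ f b) (M : Yosida B) : Yosida A :=
  ofHom ((ev M).comp f) fun a => by
    rw [abs, AlgHom.comp_apply, hf, ev_sup, map_neg, map_neg]; rfl

theorem ev_comap (f : A →ₐ[ℝ] B) (hf : ∀ a b, f (a ⊔ b) = f a ⊔ f b) (M : Yosida B) (a : A) :
    ev (comap f hf M) a = ev M (f a) :=
  ev_ofHom _ _ a

theorem continuous_comap (f : A →ₐ[ℝ] B) (hf : ∀ a b, f (a ⊔ b) = f a ⊔ f b) :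
    Continuous (comap f hf) := by
  refine continuous_iff_isClosed.2 fun F hF => ?_
  obtain ⟨I, -, rfl⟩ := isClosed_iff_zeroSet.1 hF
  have : comap f hf ⁻¹' zeroSet I = ⋂ a ∈ I, {M | ev M (f a) = 0} := by
    ext M
    simp only [Set.mem_preimage, Set.mem_iInter, Set.mem_ofPred_eq, ← ev_comap f hf,
      ← mem_iff_ev_eq_zero]
    rfl
  rw [this]
  exact isClosed_biInter fun a _ => isClosed_eq (continuous_ev _) continuous_const

/-- The homomorphism of function algebras induced by an `ℓ`-algebra homomorphism. -/
noncomputable def functionMap (f : A →ₐ[ℝ] B) (hf : ∀ a b, f (a ⊔ b) = f a ⊔ f b) :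
    C(Yosida A, ℝ) →ₐ[ℝ] C(Yosida B, ℝ) :=
  ContinuousMap.compRightAlgHom ℝ ℝ ⟨comap f hf, continuous_comap f hf⟩

theorem functionMap_yosidaMap (f : A →ₐ[ℝ] B) (hf : ∀ a b, f (a ⊔ b) = f a ⊔ f b) (a : A) :
    functionMap f hf (yosidaMap A a) = yosidaMap B (f a) := by
  ext M
  exact ev_comap f hf M a

/-- Both sides are continuous in `h` and agree on the dense image of `A`, so no back-and-forth
condition on `comap` has to be checked. -/
theorem functionMap_boxC (f : A →ₐ[ℝ] B) (hf : ∀ a b, f (a ⊔ b) = f a ⊔ f b) {box : A → A}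
    {box' : B → B} (hb : IsModalOperator box) (hb' : IsModalOperator box')
    (hbox : ∀ a, f (box a) = box' (f a)) (h : C(Yosida A, ℝ)) :
    functionMap f hf (boxC hb.isKHFrame h) = boxC hb'.isKHFrame (functionMap f hf h) := by
  have hc : Continuous (functionMap f hf) := ContinuousMap.continuous_precomp _
  refine congrFun (denseRange_yosidaMap.equalizer (hc.comp (continuous_boxC _))
    ((continuous_boxC _).comp hc) (funext fun a => ?_)) h
  simp only [Function.comp_apply, ← hb.yosidaMap_box, ← hb'.yosidaMap_box, functionMap_yosidaMap,
    hbox]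

/-- Such a map is monotone and fixes real constants, hence is 1-Lipschitz. -/
theorem continuous_of_map_sup {X Z : Type u} [TopologicalSpace X] [CompactSpace X]
    [TopologicalSpace Z] [CompactSpace Z] (φ : C(X, ℝ) →ₐ[ℝ] C(Z, ℝ))
    (hφ : ∀ f g, φ (f ⊔ g) = φ f ⊔ φ g) : Continuous φ := by
  have hmono : Monotone φ := fun f g h => by rw [← sup_eq_right, ← hφ, sup_eq_right.2 h]
  have key : ∀ f g : C(X, ℝ), ∀ z, φ f z ≤ φ g z + dist f g := fun f g z => by
    have h : f ≤ g + algebraMap ℝ C(X, ℝ) (dist f g) := ContinuousMap.le_def.2 fun x => by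
      have := (le_abs_self _).trans (ContinuousMap.dist_apply_le_dist (f := f) (g := g) x)
      suffices f x ≤ g x + dist f g by simpa
      linarith
    have h2 := hmono h z
    rw [map_add, AlgHom.commutes] at h2
    simpa using h2
  refine (LipschitzWith.of_dist_le_mul (K := 1) fun f g => ?_).continuous
  rw [NNReal.coe_one, one_mul, ContinuousMap.dist_le dist_nonneg]
  intro z
  have h1 := key f g z
  have h2 := key g f z
  rw [dist_comm] at h2
  rw [Real.dist_eq, abs_sub_le_iff]
  exact ⟨sub_le_iff_le_add'.2 h1, sub_le_iff_le_add'.2 h2⟩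

theorem algHom_ext_of_yosidaMap {φ ψ : C(Yosida A, ℝ) →ₐ[ℝ] B}
    (hφ : ∀ f g, φ (f ⊔ g) = φ f ⊔ φ g) (hψ : ∀ f g, ψ (f ⊔ g) = ψ f ⊔ ψ g)
    (h : ∀ a, φ (yosidaMap A a) = ψ (yosidaMap A a)) : φ = ψ := by
  -- Embedding `B` in `C(Y_B)` supplies a topology in which the density argument works, with no
  -- completeness of `B`.
  have hc : ∀ χ : C(Yosida A, ℝ) →ₐ[ℝ] B, (∀ f g, χ (f ⊔ g) = χ f ⊔ χ g) →
      Continuous ((yosidaMap B).comp χ) := fun χ hχ =>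
    continuous_of_map_sup _ fun f g => by
      rw [AlgHom.comp_apply, hχ, yosidaMap_sup]; rfl
  refine AlgHom.ext fun k => yosidaMap_injective ?_
  exact congrFun (denseRange_yosidaMap.equalizer (hc φ hφ) (hc ψ hψ)
    (funext fun a => congrArg (yosidaMap B) (h a))) k

/-- The extension of an `ℓ`-algebra homomorphism `A → B` to `C(Y_A)`, where `B` is uniformly
complete. -/
noncomputable def lift (hB : UniformlyComplete B) (f : A →ₐ[ℝ] B)
    (hf : ∀ a b, f (a ⊔ b) = f a ⊔ f b) : C(Yosida A, ℝ) →ₐ[ℝ] B :=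
  (AlgEquiv.ofBijective (yosidaMap B)
    ⟨yosidaMap_injective, hB.yosidaMap_surjective⟩).symm.toAlgHom.comp (functionMap f hf)

theorem yosidaMap_lift (hB : UniformlyComplete B) (f : A →ₐ[ℝ] B)
    (hf : ∀ a b, f (a ⊔ b) = f a ⊔ f b) (h : C(Yosida A, ℝ)) :
    yosidaMap B (lift hB f hf h) = functionMap f hf h :=
  (AlgEquiv.ofBijective (yosidaMap B)
    ⟨yosidaMap_injective, hB.yosidaMap_surjective⟩).apply_symm_apply _

theorem lift_yosidaMap (hB : UniformlyComplete B) (f : A →ₐ[ℝ] B)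
    (hf : ∀ a b, f (a ⊔ b) = f a ⊔ f b) (a : A) : lift hB f hf (yosidaMap A a) = f a :=
  yosidaMap_injective (by rw [yosidaMap_lift, functionMap_yosidaMap])

theorem lift_inf (hB : UniformlyComplete B) (f : A →ₐ[ℝ] B)
    (hf : ∀ a b, f (a ⊔ b) = f a ⊔ f b) (h k : C(Yosida A, ℝ)) :
    lift hB f hf (h ⊓ k) = lift hB f hf h ⊓ lift hB f hf k :=
  yosidaMap_injective (by
    rw [yosidaMap_inf, yosidaMap_lift, yosidaMap_lift, yosidaMap_lift]; rfl)

theorem lift_sup (hB : UniformlyComplete B) (f : A →ₐ[ℝ] B)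
    (hf : ∀ a b, f (a ⊔ b) = f a ⊔ f b) (h k : C(Yosida A, ℝ)) :
    lift hB f hf (h ⊔ k) = lift hB f hf h ⊔ lift hB f hf k :=
  yosidaMap_injective (by
    rw [yosidaMap_sup, yosidaMap_lift, yosidaMap_lift, yosidaMap_lift]; rfl)

theorem lift_boxC (hB : UniformlyComplete B) (f : A →ₐ[ℝ] B)
    (hf : ∀ a b, f (a ⊔ b) = f a ⊔ f b) {box : A → A} {box' : B → B} (hb : IsModalOperator box)
    (hb' : IsModalOperator box') (hbox : ∀ a, f (box a) = box' (f a)) (h : C(Yosida A, ℝ)) :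
    lift hB f hf (boxC hb.isKHFrame h) = box' (lift hB f hf h) :=
  yosidaMap_injective (by
    rw [hb'.yosidaMap_box, yosidaMap_lift, yosidaMap_lift, functionMap_boxC f hf hb hb' hbox])

end Functoriality

end BAL

/-! ### The reflection of `mbaℓ` onto `mubaℓ`. -/

namespace MBAL

open BAL

theorem isKHFrame (A : MBAL.{u}) : IsKHFrame A.R := A.isModal.isKHFrame

/-- The object `(C(Y_A), □_{R_□})` of `mubaℓ`. -/
noncomputable abbrev completion (A : MBAL.{u}) : MUBAL.{u} := ofFrame A.isKHFrame

/-- The morphism `ζ_A : (A, □) → (C(Y_A), □_{R_□})`. -/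
noncomputable def zeta (A : MBAL.{u}) : A ⟶ A.completion.obj where
  toAlgHom := yosidaMap A.carrier
  map_inf := yosidaMap_inf
  map_sup := yosidaMap_sup
  map_box a := ContinuousMap.ext fun M => A.isModal.ev_box a M

theorem isUniformCompletion_zeta (A : MBAL.{u}) : IsUniformCompletion (zeta A) where
  complete := A.completion.property
  injective := yosidaMap_injective
  norm_eq := lNorm_yosidaMap
  dense b _ hε := exists_lNorm_sub_yosidaMap_lt (asFun A.isKHFrame b) hε

/-- The extension of a morphism `A ⟶ B` to `(C(Y_A), □_{R_□})`, where `B` is uniformly complete. -/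
noncomputable def extend {A : MBAL.{u}} {B : MUBAL.{u}} (f : A ⟶ B.obj) :
    A.completion.obj ⟶ B.obj where
  toAlgHom := lift B.property f.toAlgHom f.map_sup
  map_inf := lift_inf B.property f.toAlgHom f.map_sup
  map_sup := lift_sup B.property f.toAlgHom f.map_sup
  map_box := lift_boxC B.property f.toAlgHom f.map_sup A.isModal B.obj.isModal f.map_box

theorem zeta_extend {A : MBAL.{u}} {B : MUBAL.{u}} (f : A ⟶ B.obj) :
    zeta A ≫ extend f = f :=
  Hom.ext (AlgHom.ext fun a => lift_yosidaMap B.property f.toAlgHom f.map_sup a)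

theorem hom_ext_of_zeta {A B : MBAL.{u}} {g g' : A.completion.obj ⟶ B}
    (h : zeta A ≫ g = zeta A ≫ g') : g = g' :=
  Hom.ext (algHom_ext_of_yosidaMap g.map_sup g'.map_sup fun a =>
    congrArg (fun k : A ⟶ B => Hom.fn k a) h)

/-- Morphisms out of `(C(Y_A), □_{R_□})` correspond to morphisms out of `A`. -/
noncomputable def completionHomEquiv (A : MBAL.{u}) (B : MUBAL.{u}) :
    (A.completion ⟶ B) ≃ (A ⟶ inclusion.obj B) where
  toFun g := zeta A ≫ inclusion.map g
  invFun f := ObjectProperty.homMk (extend f)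
  left_inv g := by
    refine inclusion.map_injective (hom_ext_of_zeta ?_)
    exact zeta_extend _
  right_inv f := zeta_extend f

theorem completionHomEquiv_naturality (A : MBAL.{u}) (B B' : MUBAL.{u}) (g : B ⟶ B')
    (h : A.completion ⟶ B) : completionHomEquiv A B' (h ≫ g) =
      completionHomEquiv A B h ≫ inclusion.map g := by
  simp [completionHomEquiv]

/-- The reflector `(A, □) ↦ (C(Y_A), □_{R_□})`. -/
noncomputable abbrev reflective : Reflective inclusion.{u} where
  L := Adjunction.leftAdjointOfEquiv completionHomEquiv completionHomEquiv_naturality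
  adj := Adjunction.adjunctionOfEquivLeft completionHomEquiv completionHomEquiv_naturality

end MBAL

theorem mainTheorem5 :
    ∃ (hframe : ∀ A : MBAL.{u}, BAL.IsKHFrame A.R)
      (ζ : ∀ A : MBAL.{u}, A ⟶ (MBAL.ofFrame (hframe A)).obj),
      -- `ζ_A(a)(M)` is the unique real number `r` with `a + M = r + M`
      (∀ (A : MBAL.{u}) (a : A.carrier) (M : A.Y) (r : ℝ),
        MBAL.asFun (hframe A) (MBAL.Hom.fn (ζ A) a) M = r ↔ BAL.IsResidue a M r) ∧
      -- `ζ_A(□ a) = □_{R_□} ζ_A(a)`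
      (∀ (A : MBAL.{u}) (a : A.carrier) (x : A.Y),
        MBAL.asFun (hframe A) (MBAL.Hom.fn (ζ A) (A.box a)) x =
          BAL.boxFun A.R (MBAL.asFun (hframe A) (MBAL.Hom.fn (ζ A) a)) x) ∧
      (∀ A : MBAL.{u}, MBAL.IsUniformCompletion (ζ A)) ∧
      -- the inclusion has a left adjoint, whose unit at `A` is `ζ_A`
      ∃ (refl : Reflective MBAL.inclusion.{u})
        (e : ∀ A : MBAL.{u}, refl.L.obj A ≅ MBAL.ofFrame (hframe A)),
        ∀ A : MBAL.{u}, refl.adj.unit.app A ≫ MBAL.inclusion.map (e A).hom = ζ A := by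
  refine ⟨MBAL.isKHFrame, MBAL.zeta, fun A a M r => BAL.ev_eq_iff,
    fun A a x => A.isModal.ev_box a x, MBAL.isUniformCompletion_zeta,
    MBAL.reflective, fun A => Iso.refl _, fun A => ?_⟩
  -- The unit is the image of the identity under the hom-set bijection, that is, `ζ_A` followed by
  -- an identity.
  have h : MBAL.reflective.adj.unit.app A = MBAL.zeta A :=
    (Adjunction.adjunctionOfEquivLeft_unit_app _ _ A).trans
      (by simp [MBAL.completionHomEquiv])
  rw [Iso.refl_hom, CategoryTheory.Functor.map_id]
  exact (Category.comp_id _).trans h
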